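/- Let $\mathbb X$ be a real Hausdorff locally convex space, possibly of infinite dimension, with its Borel $\sigma$-algebra and topological dual $\mathbb X^*$, and let $C$ be a symmetric positive definite bilinear form on $\mathbb X^*$. Let $\phi_0:\mathbb R\to\mathbb C$ be such that $\phi_0(\|t\|^2)$ is a characteristic function on $\mathbb R^n$ for every $n$ (this is automatic below if $\dim\mathbb X=\infty$) and $\phi_0(s)\to0$ as $s\to\infty$; equivalently, $\phi_0(s)=E[e^{-sV^2/2}]$ for $s\ge 0$, with a random variable $V>0$. Let $X$ be a centered elliptical random element of $\mathbb X$ with dispersion $C$ and generator $\phi_0$, that is, $E[e^{ig(X)}]=\phi_0(C(g,g))$ for all $g\in\mathbb X^*$; let $P$ be its law. Let $\mathcal K$ be the completion of $\mathbb X^*$ for the inner product $C$, whose extension to $\mathcal K$ is again denoted by $C$. The Cameron–Martin space $\mathbb H$ consists of the $h\in\mathbb X$ for which there is a $k\in\mathcal K$ with $g(h)=C(k,g)$ for all $g\in\mathbb X^*$; then $k$ is unique, and $\|h\|_{\mathbb H}=\|k\|_{\mathcal K}$ (put $\|h\|_{\mathbb H}=\infty$ if $h\notin\mathbb H$). A version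 of $g\in\mathcal K$ is given by a sequence $g_n\in\mathbb X^*$ with $g_n\to g$ in $\mathcal K$ for which $g_n(x)$ converges for $P$-almost every $x$; put $g(x)=\lim_n g_n(x)$ where this limit exists. Every $g\in\mathcal K$ has a version, any two versions agree $P$-almost everywhere, and every version is defined on $\mathbb H$, with $g(h)=C(k,g)$ for $h\in\mathbb H$ and $k$ as above. Let $(\mathcal D,\rho)$ be a metric space, $T:\mathcal D\to\mathbb X$, $\sigma>0$, $\widetilde T_D=T_D+\sigma X$, and assume that the sensitivity $\Delta=\sup_{\rho(D,D')\le1}\|T_D-T_{D'}\|_{\mathbb H}$ is finite. Fix $d$. Below, $g_1,\dots,g_d\in\mathcal K$ are taken with versions that are defined at all $T_D$ (this is automatic if all $T_D\in\mathbb H$, and each $g\in\mathbb X^*$ has such a version). There is a decreasing function $f:[0,\infty)\to(0,\infty]$, depending only on $d$ and $\phi_0$, such that the probability measure on $\mathbb R^d$ with characteristic function $\phi_0(\|t\|^2)$ has a density proportional to $f(\|x\|^2)$. For every such $f$ the following hold. (1) If $g_1,\dots,g_d\in\mathcal K$ are linearly independent, then, with $\Sigma=(C(g_i,g_j))_{i,j}$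 and $\mu_D=(g_i(T_D))_i$, the vector $(g_i(\widetilde T_D))_{i\le d}$ has for every $D$ a density proportional to $f\big(\sigma^{-2}(x-\mu_D)^\top\Sigma^{-1}(x-\mu_D)\big)$, with a constant of proportionality that does not depend on $D$. (2) If $f(0)<\infty$ and $\limsup_{c\to\infty}f((c-\Delta)^2)/f(c^2)<\infty$, then there is an $\epsilon\ge0$ with $$e^{\epsilon}=\sup_{c\ge\sigma^{-1}\Delta}\frac{f\big((c-\sigma^{-1}\Delta)^2\big)}{f(c^2)}<\infty$$ such that, for all $g_1,\dots,g_d\in\mathcal K$, the laws of $(g_i(\widetilde T_D))_{i\le d}$, $D\in\mathcal D$, are $\epsilon$-differentially private: $\Pr[(g_i(\widetilde T_D))_i\in A]\le e^{\epsilon}\Pr[(g_i(\widetilde T_{D'}))_i\in A]$ for all Borel sets $A\subseteq\mathbb R^d$ and all $D,D'$ with $\rho(D,D')\le1$. -/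

import Mathlib

open MeasureTheory Filter Topology
open scoped ENNReal

namespace EllipticalDP

noncomputable section

/-- The dispersion form of an elliptical measure: a symmetric positive definite bilinear form on the
topological dual of `X`. (Its continuity is not needed and therefore not required.) -/
structure DispersionForm (X : Type*) [AddCommGroup X] [Module ℝ X] [TopologicalSpace X]
    [IsTopologicalAddGroup X] [ContinuousSMul ℝ X] where
  form : LinearMap.BilinForm ℝ (X →L[ℝ] ℝ)
  symm : ∀ g₁ g₂, form g₁ g₂ = form g₂ g₁
  pos : ∀ g, g ≠ 0 → 0 < form g g

section Space

variable {X : Type*} [AddCommGroup X] [Module ℝ X] [TopologicalSpace X]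
  [IsTopologicalAddGroup X] [ContinuousSMul ℝ X]

/-- A copy of the dual of `X`, to carry the inner product given by `C`. -/
def PreK (_C : DispersionForm X) : Type _ := X →L[ℝ] ℝ

instance (C : DispersionForm X) : AddCommGroup (PreK C) :=
  inferInstanceAs (AddCommGroup (X →L[ℝ] ℝ))

instance (C : DispersionForm X) : Module ℝ (PreK C) :=
  inferInstanceAs (Module ℝ (X →L[ℝ] ℝ))

/-- The identity from the dual of `X` to its copy. -/
def toPreK (C : DispersionForm X) : (X →L[ℝ] ℝ) ≃ₗ[ℝ] PreK C := LinearEquiv.refl ℝ _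

/-- The inner product `⟨g₁, g₂⟩ = C(g₁, g₂)` on the dual of `X`. -/
@[reducible]
def preKCore (C : DispersionForm X) : InnerProductSpace.Core ℝ (PreK C) where
  inner g₁ g₂ := C.form ((toPreK C).symm g₁) ((toPreK C).symm g₂)
  conj_inner_symm g₁ g₂ := C.symm _ _
  re_inner_nonneg g := by
    rcases eq_or_ne ((toPreK C).symm g) 0 with h | h
    · simp [h]
    · exact (C.pos _ h).le
  add_left g₁ g₂ g₃ := by simp
  smul_left g₁ g₂ r := by simp
  definite g h := by
    by_contra hg
    exact (C.pos ((toPreK C).symm g) (by simpa using hg)).ne' h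

instance (C : DispersionForm X) : NormedAddCommGroup (PreK C) :=
  (preKCore C).toNormedAddCommGroup

instance (C : DispersionForm X) : InnerProductSpace ℝ (PreK C) :=
  InnerProductSpace.ofCore (preKCore C).toCore

/-- The Hilbert space `𝒦`: the completion of the dual of `X` for the inner product `C`. -/
abbrev K (C : DispersionForm X) : Type _ := UniformSpace.Completion (PreK C)

/-- The canonical map from the dual of `X` to `𝒦`. -/
def toK (C : DispersionForm X) (g : X →L[ℝ] ℝ) : K C := ((toPreK C g : PreK C) : K C)

/-- `h = C(k)`: the vector `h` of `X` is the image of `k ∈ 𝒦` under the dispersion operator,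
that is, `g(h) = ⟨k, g⟩` for every continuous linear functional `g`. -/
def IsImage (C : DispersionForm X) (k : K C) (h : X) : Prop :=
  ∀ g : X →L[ℝ] ℝ, g h = inner ℝ k (toK C g)

/-- The Cameron–Martin space of `C`. -/
def cameronMartin (C : DispersionForm X) : Set X := {h | ∃ k : K C, IsImage C k h}

/-- The Cameron–Martin norm: `‖k‖` if `h = C(k)` (such a `k` is unique), and `∞` if `h` is not in the
Cameron–Martin space. -/
def cmNorm (C : DispersionForm X) (h : X) : ℝ≥0∞ :=
  ⨅ (k : K C) (_ : IsImage C k h), ‖k‖ₑ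

/-- The sensitivity `sup_{d(D, D') ≤ 1} ‖T_D - T_{D'}‖` of a summary in the Cameron–Martin norm. It
is `∞` if some such difference is not in the Cameron–Martin space. -/
def sensitivity {𝓓 : Type*} [MetricSpace 𝓓] (C : DispersionForm X) (T : 𝓓 → X) : ℝ≥0∞ :=
  ⨆ (D : 𝓓) (D' : 𝓓) (_ : dist D D' ≤ 1), cmNorm C (T D - T D')

/-- `P` is elliptical with centre `μ`, dispersion form `C` and characteristic generator `φ₀`. -/
def IsElliptical [MeasurableSpace X] (P : Measure X) (μ : X) (C : DispersionForm X)
    (φ₀ : ℝ → ℂ) : Prop :=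
  IsProbabilityMeasure P ∧ ∀ g : X →L[ℝ] ℝ,
    ∫ x, Complex.exp (Complex.I * (g x : ℂ)) ∂P
      = Complex.exp (Complex.I * (g μ : ℂ)) * φ₀ (C.form g g)

/-- A version of `g ∈ 𝒦` as a function on `X`: elements of `𝒦` are limits of continuous linear
functionals `gₙ`, and the sequence is chosen so that `gₙ(x)` converges for `P`-almost every `x`. -/
structure Version [MeasurableSpace X] (C : DispersionForm X) (P : Measure X) (g : K C) where
  seq : ℕ → (X →L[ℝ] ℝ)
  tendsto_seq : Tendsto (fun n => toK C (seq n)) atTop (𝓝 g)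
  ae_converges : ∀ᵐ x ∂P, ∃ l : ℝ, Tendsto (fun n => seq n x) atTop (𝓝 l)

/-- The linear subspace of those `x` at which the version of `g` is defined. -/
def Version.domain [MeasurableSpace X] {C : DispersionForm X} {P : Measure X} {g : K C}
    (v : Version C P g) : Set X :=
  {x | ∃ l : ℝ, Tendsto (fun n => v.seq n x) atTop (𝓝 l)}

/-- The value `g(x) = lim gₙ(x)`, meaningful for `x` in the domain. -/
def Version.eval [MeasurableSpace X] {C : DispersionForm X} {P : Measure X} {g : K C}
    (v : Version C P g) (x : X) : ℝ :=
  limUnder atTop (fun n => v.seq n x)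

/-- The law of the sanitized summary `t + σ X`, where `X` has law `P`. -/
def mechanism [MeasurableSpace X] (P : Measure X) (σ : ℝ) (t : X) : Measure X :=
  P.map (fun x => t + σ • x)

end Space

/-- `φ₀` generates a family of elliptical distributions: in every dimension `n` there is a
probability measure on `ℝⁿ` with characteristic function `φ₀(‖t‖²)`, and `φ₀` vanishes at infinity,
so that these measures have no atom at the centre.

The first condition includes `φ₀(0) = 1`, the continuity of `φ₀` at `0` from the right and the
positive definiteness of `φ₀`. It holds automatically if `φ₀` is the generator of an elliptical
measure on an infinite-dimensional space. -/
def IsEllipticalFamily (φ₀ : ℝ → ℂ) : Prop :=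
  (∀ n : ℕ, ∃ Q : Measure (EuclideanSpace ℝ (Fin n)), IsProbabilityMeasure Q ∧
    ∀ t, charFun Q t = φ₀ (‖t‖ ^ 2)) ∧
  Tendsto φ₀ atTop (𝓝 0)

/-- `f` is a density generator, in dimension `d`, of the elliptical family of `φ₀`: a decreasing
positive function `[0, ∞) → (0, ∞]` such that the standard `d`-dimensional member of the family
(centre `0`, dispersion matrix the identity) has a density proportional to `f(‖x‖²)`. Only the values
of `f` on `[0, ∞)` matter. -/
def IsDensityGenerator (d : ℕ) (φ₀ : ℝ → ℂ) (f : ℝ → ℝ≥0∞) : Prop :=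
  AntitoneOn f (Set.Ici 0) ∧ (∀ y, 0 ≤ y → 0 < f y) ∧
  ∃ Q : Measure (EuclideanSpace ℝ (Fin d)), IsProbabilityMeasure Q ∧
    (∀ t, charFun Q t = φ₀ (‖t‖ ^ 2)) ∧
    ∃ k : ℝ≥0∞, k ≠ 0 ∧ k ≠ ⊤ ∧ Q = volume.withDensity (fun x => k * f (‖x‖ ^ 2))

/-- `(ε, δ)`-differential privacy of a family of measures indexed by a metric space of databases. -/
def IsDP {𝓓 Y : Type*} [MetricSpace 𝓓] [MeasurableSpace Y] (ε δ : ℝ) (M : 𝓓 → Measure Y) : Prop :=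
  ∀ D D' : 𝓓, dist D D' ≤ 1 → ∀ A : Set Y, MeasurableSet A →
    M D A ≤ ENNReal.ofReal (Real.exp ε) * M D' A + ENNReal.ofReal δ

/-- `sup_{c ≥ b} f((c - b)²) / f(c²)`. -/
def privacyRatio (f : ℝ → ℝ≥0∞) (b : ℝ) : ℝ≥0∞ :=
  ⨆ (c : ℝ) (_ : b ≤ c), f ((c - b) ^ 2) / f (c ^ 2)

end

end EllipticalDP

open EllipticalDP

namespace EllipticalDP

section Schoenberg

open ProbabilityTheory

variable {φ₀ : ℝ → ℂ}

lemma exists_charFun_real_eq (hφ₀ : IsEllipticalFamily φ₀) :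
    ∃ Q : Measure (EuclideanSpace ℝ (Fin 1)), IsProbabilityMeasure Q ∧
      ∀ s, 0 ≤ s → φ₀ s = charFun Q (EuclideanSpace.single 0 (√s)) := by
  obtain ⟨Q, hQ, h⟩ := hφ₀.1 1
  refine ⟨Q, hQ, fun s hs => ?_⟩
  rw [h, PiLp.norm_single, Real.norm_eq_abs, sq_abs, Real.sq_sqrt hs]

lemma IsEllipticalFamily.map_zero (hφ₀ : IsEllipticalFamily φ₀) : φ₀ 0 = 1 := by
  obtain ⟨Q, hQ, h⟩ := hφ₀.1 0
  simpa using (h 0).symm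

lemma IsEllipticalFamily.norm_le_one (hφ₀ : IsEllipticalFamily φ₀) {s : ℝ} (hs : 0 ≤ s) :
    ‖φ₀ s‖ ≤ 1 := by
  obtain ⟨Q, hQ, h⟩ := exists_charFun_real_eq hφ₀
  rw [h s hs]
  exact norm_charFun_le_one _

lemma IsEllipticalFamily.continuousOn (hφ₀ : IsEllipticalFamily φ₀) :
    ContinuousOn φ₀ (Set.Ici 0) := by
  obtain ⟨Q, hQ, h⟩ := exists_charFun_real_eq hφ₀
  have h1 : Continuous fun s : ℝ => (EuclideanSpace.single 0 (√s) : EuclideanSpace ℝ (Fin 1)) :=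
    (PiLp.continuous_toLp 2 _).comp (continuous_pi fun i => by
      fin_cases i; simpa using Real.continuous_sqrt)
  exact (continuous_charFun.comp h1).continuousOn.congr fun s hs => h s hs

/-- Averaging the characteristic function of a measure over a standard Gaussian gives its Laplace
transform in the squared norm. -/
lemma integral_generator_stdGaussian {n : ℕ} {Q : Measure (EuclideanSpace ℝ (Fin n))}
    [IsProbabilityMeasure Q] (hQ : ∀ t, charFun Q t = φ₀ (‖t‖ ^ 2)) {a : ℝ} (ha : 0 ≤ a) :
    ∫ y, φ₀ (a * ‖y‖ ^ 2) ∂stdGaussian (EuclideanSpace ℝ (Fin n))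
      = ∫ x, Complex.exp (-(a * ‖x‖ ^ 2 / 2 : ℝ)) ∂Q := by
  have h1 : ∀ y : EuclideanSpace ℝ (Fin n), φ₀ (a * ‖y‖ ^ 2)
      = ∫ x, Complex.exp ((√a * inner ℝ x y : ℝ) * Complex.I) ∂Q := fun y => by
    have := hQ (√a • y)
    rw [norm_smul, mul_pow, Real.norm_eq_abs, sq_abs, Real.sq_sqrt ha] at this
    rw [← this, charFun_apply]
    simp [inner_smul_right]
  have h2 : ∀ x : EuclideanSpace ℝ (Fin n), Complex.exp (-(a * ‖x‖ ^ 2 / 2 : ℝ))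
      = ∫ y, Complex.exp ((√a * inner ℝ x y : ℝ) * Complex.I)
          ∂stdGaussian (EuclideanSpace ℝ (Fin n)) := fun x => by
    have := charFun_stdGaussian (√a • x)
    rw [charFun_apply] at this
    simp only [inner_smul_right] at this
    simp_rw [real_inner_comm _ x]
    rw [this, norm_smul, Real.norm_eq_abs, abs_of_nonneg (Real.sqrt_nonneg a)]
    congr 1
    rw [← Complex.ofReal_pow, mul_pow, Real.sq_sqrt ha]
    push_cast
    ring
  simp_rw [h1, h2]
  refine integral_integral_swap ?_
  refine Integrable.mono' (integrable_const (1 : ℝ)) ?_ (.of_forall fun z => ?_)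
  · exact (by fun_prop : Continuous fun z : EuclideanSpace ℝ (Fin n) × EuclideanSpace ℝ (Fin n) =>
      Complex.exp ((√a * inner ℝ z.2 z.1 : ℝ) * Complex.I)).aestronglyMeasurable
  · exact (Complex.norm_exp_ofReal_mul_I _).le

/-- The law of large numbers for the squared norm of a standard Gaussian vector, tested against a
generator. -/
lemma tendsto_integral_generator_stdGaussian (hφ₀ : IsEllipticalFamily φ₀) {a : ℝ} (ha : 0 ≤ a) :
    Tendsto (fun n : ℕ => ∫ y, φ₀ (a / n * ‖y‖ ^ 2) ∂stdGaussian (EuclideanSpace ℝ (Fin n)))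
      atTop (𝓝 (φ₀ a)) := by
  let μ : Measure (ℕ → ℝ) := Measure.infinitePi fun _ => gaussianReal 0 1
  have hmap : ∀ n : ℕ, stdGaussian (EuclideanSpace ℝ (Fin n))
      = μ.map (fun ω => WithLp.toLp 2 fun i : Fin n => ω i) := fun n => by
    rw [← map_pi_eq_stdGaussian, ← Measure.infinitePi_eq_pi,
      ← Measure.map_infinitePi_infinitePi_of_inj (P := fun _ : ℕ => gaussianReal 0 1)
        (f := fun i : Fin n => (i : ℕ)) Fin.val_injective, Measure.map_map]
    · rfl
    · fun_prop
    · fun_prop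
  have hev : ∀ i : ℕ, μ.map (fun ω => ω i) = gaussianReal 0 1 := fun i =>
    Measure.infinitePi_map_eval (fun _ : ℕ => gaussianReal 0 1) i
  have hint : Integrable (fun x : ℝ => x ^ 2) (gaussianReal 0 1) := by
    simpa using (memLp_id_gaussianReal (μ := 0) (v := 1) 2).integrable_sq
  have hmean : ∫ x, x ^ 2 ∂gaussianReal 0 1 = 1 := by
    have := variance_id_gaussianReal (μ := 0) (v := 1)
    rw [variance_eq_integral aemeasurable_id] at this
    simpa using this
  have hlln : ∀ᵐ ω ∂μ, Tendsto (fun n : ℕ => (n : ℝ)⁻¹ • ∑ i ∈ Finset.range n, ω i ^ 2) atTop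
      (𝓝 1) := by
    have := strong_law_ae (μ := μ) (fun (i : ℕ) (ω : ℕ → ℝ) => ω i ^ 2) ?_ ?_ ?_
    · convert this using 4
      rw [← hmean, ← hev 0, integral_map (measurable_pi_apply 0).aemeasurable (by fun_prop)]
    · rw [← hev 0] at hint
      exact (integrable_map_measure (f := fun ω : ℕ → ℝ => ω 0) (g := fun x => x ^ 2) (by fun_prop)
        (measurable_pi_apply 0).aemeasurable).1 hint
    · intro i j hij
      exact (iIndepFun_infinitePi (P := fun _ : ℕ => gaussianReal 0 1)
        (X := fun _ x => x ^ 2) (fun _ => by fun_prop)).indepFun hij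
    · intro i
      have : IdentDistrib (fun ω : ℕ → ℝ => ω i) (fun ω => ω 0) μ μ :=
        ⟨(measurable_pi_apply i).aemeasurable, (measurable_pi_apply 0).aemeasurable, by rw [hev, hev]⟩
      exact this.comp (u := fun x => x ^ 2) (by fun_prop)
  let φ : ℝ → ℂ := fun s => φ₀ (max s 0)
  have hφ : Continuous φ :=
    hφ₀.continuousOn.comp_continuous (by fun_prop) fun s => Set.mem_Ici.2 (le_max_right _ _)
  have heq : ∀ n : ℕ, ∫ y, φ₀ (a / n * ‖y‖ ^ 2) ∂stdGaussian (EuclideanSpace ℝ (Fin n))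
      = ∫ ω, φ (a * ((n : ℝ)⁻¹ • ∑ i ∈ Finset.range n, ω i ^ 2)) ∂μ := fun n => by
    have h0 : ∀ y : EuclideanSpace ℝ (Fin n), φ₀ (a / n * ‖y‖ ^ 2) = φ (a / n * ‖y‖ ^ 2) :=
      fun y => by simp only [φ]; rw [max_eq_left (by positivity)]
    simp_rw [h0]
    have hL : Measurable fun ω : ℕ → ℝ => WithLp.toLp 2 fun i : Fin n => ω i :=
      (WithLp.measurable_toLp 2 _).comp (measurable_pi_lambda _ fun i => measurable_pi_apply _)
    rw [hmap n, integral_map hL.aemeasurable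
      (by exact (by fun_prop : Continuous fun y : EuclideanSpace ℝ (Fin n) =>
        φ (a / n * ‖y‖ ^ 2)).aestronglyMeasurable)]
    refine integral_congr_ae (.of_forall fun ω => ?_)
    simp only [EuclideanSpace.real_norm_sq_eq]
    rw [Finset.sum_range fun i => ω i ^ 2, smul_eq_mul]
    congr 1
    ring
  simp_rw [heq]
  have hlim : φ₀ a = ∫ ω, φ₀ a ∂μ := by simp
  rw [hlim]
  refine tendsto_integral_of_dominated_convergence (fun _ => 1) (fun n => ?_)
    (integrable_const _) (fun n => .of_forall fun ω => hφ₀.norm_le_one (le_max_right _ _)) ?_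
  · exact (by fun_prop : Continuous fun ω : ℕ → ℝ =>
      φ (a * ((n : ℝ)⁻¹ • ∑ i ∈ Finset.range n, ω i ^ 2))).aestronglyMeasurable
  · filter_upwards [hlln] with ω hω
    have := (hφ.tendsto (a * 1)).comp (hω.const_mul a)
    simpa [φ, max_eq_left ha, Function.comp_def] using this

/-- A generator of elliptical distributions in every dimension is given by the moments of a
probability measure on the unit interval. -/
lemma exists_moment_measure (hφ₀ : IsEllipticalFamily φ₀) :
    ∃ m : Measure unitInterval, IsProbabilityMeasure m ∧
      ∀ a : ℝ, 0 < a → ((∫ y, (y : ℝ) ^ a ∂m : ℝ) : ℂ) = φ₀ a := by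
  choose Q hQ hQφ using hφ₀.1
  let e : ∀ n : ℕ, EuclideanSpace ℝ (Fin n) → unitInterval := fun n x =>
    ⟨Real.exp (-(‖x‖ ^ 2 / (2 * n))), (Real.exp_pos _).le, Real.exp_le_one_iff.2 (by
      rw [neg_nonpos]; positivity)⟩
  have he : ∀ n, Measurable (e n) := fun n =>
    (Continuous.subtype_mk (by fun_prop) _).measurable
  let m : ℕ → ProbabilityMeasure unitInterval := fun n =>
    ⟨(Q n).map (e n), Measure.isProbabilityMeasure_map (he n).aemeasurable⟩
  obtain ⟨μ, hμ⟩ : ∃ μ, Tendsto m (hyperfilter ℕ : Filter ℕ) (𝓝 μ) :=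
    ⟨_, ((hyperfilter ℕ).map m).le_nhds_lim⟩
  refine ⟨μ, inferInstance, fun a ha => ?_⟩
  rw [ProbabilityMeasure.tendsto_iff_forall_integral_tendsto] at hμ
  let p : C(unitInterval, ℝ) := ⟨fun y => (y : ℝ) ^ a,
    continuous_subtype_val.rpow_const fun _ => Or.inr ha.le⟩
  have h1 := (Complex.continuous_ofReal.tendsto _).comp (hμ (BoundedContinuousFunction.mkOfCompact p))
  have h2 : Tendsto (fun n : ℕ => ((∫ y, (y : ℝ) ^ a ∂(m n : Measure unitInterval) : ℝ) : ℂ)) atTop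
      (𝓝 (φ₀ a)) := by
    refine (tendsto_integral_generator_stdGaussian hφ₀ ha.le).congr fun n => ?_
    rw [integral_generator_stdGaussian (hQφ n) (by positivity)]
    have h3 : ∫ y, (y : ℝ) ^ a ∂(m n : Measure unitInterval)
        = ∫ x, Real.exp (-(a / n * ‖x‖ ^ 2 / 2)) ∂(Q n) := by
      change ∫ y, (y : ℝ) ^ a ∂((Q n).map (e n)) = _
      rw [integral_map (f := fun y : unitInterval => (y : ℝ) ^ a) (he n).aemeasurable
        p.continuous.aestronglyMeasurable]
      refine integral_congr_ae (.of_forall fun x => ?_)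
      simp only [e]
      rw [← Real.exp_mul]
      congr 1
      ring
    rw [h3, ← integral_complex_ofReal]
    push_cast
    rfl
  exact tendsto_nhds_unique h1 (h2.mono_left Nat.hyperfilter_le_atTop)

/-- **Schoenberg's theorem**: a generator of elliptical distributions in every dimension which
vanishes at infinity is the Laplace transform of a probability measure on `(0, ∞)`. -/
theorem exists_laplace_measure (hφ₀ : IsEllipticalFamily φ₀) :
    ∃ ν : Measure ℝ, IsProbabilityMeasure ν ∧ (∀ᵐ u ∂ν, 0 < u) ∧
      ∀ s : ℝ, 0 ≤ s → ∫ u, Complex.exp (-(s * u : ℝ)) ∂ν = φ₀ s := by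
  obtain ⟨m, hm, hmom⟩ := exists_moment_measure hφ₀
  have hpow : ∀ a : ℝ, 0 < a → Continuous fun y : unitInterval => (y : ℝ) ^ a := fun a ha =>
    continuous_subtype_val.rpow_const fun _ => Or.inr ha.le
  have hbd : ∀ a : ℝ, 0 < a → ∀ y : unitInterval, ‖(y : ℝ) ^ a‖ ≤ 1 := fun a ha y => by
    rw [Real.norm_eq_abs, abs_of_nonneg (Real.rpow_nonneg y.2.1 _)]
    exact Real.rpow_le_one y.2.1 y.2.2 ha.le
  have hlim : ∀ (a : ℕ → ℝ) (F : unitInterval → ℝ) (l : ℂ), (∀ n, 0 < a n) →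
      (∀ y : unitInterval, Tendsto (fun n => (y : ℝ) ^ a n) atTop (𝓝 (F y))) →
      Tendsto (fun n => φ₀ (a n)) atTop (𝓝 l) → ((∫ y, F y ∂m : ℝ) : ℂ) = l := by
    intro a F l ha hF hl
    refine tendsto_nhds_unique ?_ hl
    simp_rw [← fun n => hmom (a n) (ha n)]
    refine (Complex.continuous_ofReal.tendsto _).comp ?_
    exact tendsto_integral_of_dominated_convergence (fun _ => 1)
      (fun n => (hpow _ (ha n)).aestronglyMeasurable) (integrable_const _)
      (fun n => .of_forall (hbd _ (ha n))) (.of_forall hF)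
  have hone : ∀ᵐ y ∂m, y ≠ 1 := by
    have := hlim (fun n => n + 1) (Set.indicator {1} fun _ => 1) 0 (fun n => by positivity) ?_
      (hφ₀.2.comp (tendsto_atTop_add_const_right _ _ tendsto_natCast_atTop_atTop))
    · rw [integral_indicator_const _ (measurableSet_singleton _)] at this
      have h0 : m {1} = 0 := by simpa [measureReal_def, ENNReal.toReal_eq_zero_iff] using this
      exact measure_eq_zero_iff_ae_notMem.1 h0
    · intro y
      by_cases hy : y = 1
      · simp [hy]
      · have hy1 : (y : ℝ) < 1 := lt_of_le_of_ne y.2.2 fun h => hy (Subtype.ext h)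
        have := (tendsto_pow_atTop_nhds_zero_of_lt_one y.2.1 hy1).comp (tendsto_add_atTop_nat 1)
        simp only [Set.mem_singleton_iff, hy, not_false_eq_true, Set.indicator_of_notMem]
        refine this.congr fun n => ?_
        simp [← Real.rpow_natCast]
  have hzero : ∀ᵐ y ∂m, y ≠ 0 := by
    have h1 : Tendsto (fun n : ℕ => (1 : ℝ) / ((n : ℝ) + 1)) atTop (𝓝 0) :=
      tendsto_one_div_add_atTop_nhds_zero_nat
    have := hlim (fun n => 1 / ((n : ℝ) + 1)) (Set.indicator {0}ᶜ fun _ => 1) 1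
      (fun n => by positivity) ?_ ?_
    · rw [integral_indicator_const _ (measurableSet_singleton _).compl] at this
      have h0 : m.real {0}ᶜ = 1 := by simpa using this
      rw [probReal_compl_eq_one_sub (measurableSet_singleton _)] at h0
      have h2 : m {0} = 0 := by
        simpa [measureReal_def, ENNReal.toReal_eq_zero_iff] using (by linarith : m.real {0} = 0)
      exact measure_eq_zero_iff_ae_notMem.1 h2
    · intro y
      by_cases hy : y = 0
      · simp only [hy, Set.Icc.coe_zero, Set.mem_compl_iff, Set.mem_singleton_iff, not_true_eq_false,
          not_false_eq_true, Set.indicator_of_notMem]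
        refine tendsto_const_nhds.congr fun n => (Real.zero_rpow (by positivity)).symm
      · have hy0 : (y : ℝ) ≠ 0 := fun h => hy (Subtype.ext h)
        simp only [Set.mem_compl_iff, Set.mem_singleton_iff, hy, not_false_eq_true,
          Set.indicator_of_mem]
        simpa [Function.comp_def] using ((Real.continuous_const_rpow hy0).tendsto 0).comp h1
    · have := (hφ₀.continuousOn 0 (Set.mem_Ici.2 le_rfl)).tendsto.comp
        (tendsto_nhdsWithin_iff.2 ⟨h1, .of_forall fun n => Set.mem_Ici.2 (by positivity)⟩)
      rwa [hφ₀.map_zero] at this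
  have hlog : Measurable fun y : unitInterval => -Real.log y :=
    (Real.measurable_log.comp measurable_subtype_coe).neg
  have hν := Measure.isProbabilityMeasure_map (μ := m) hlog.aemeasurable
  refine ⟨m.map fun y : unitInterval => -Real.log y, hν, ?_, fun s hs => ?_⟩
  · rw [ae_map_iff hlog.aemeasurable measurableSet_Ioi]
    filter_upwards [hone, hzero] with y h1 h0
    have hy1 : (y : ℝ) < 1 := lt_of_le_of_ne y.2.2 fun h => h1 (Subtype.ext h)
    have hy0 : 0 < (y : ℝ) := lt_of_le_of_ne y.2.1 fun h => h0 (Subtype.ext h.symm)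
    exact neg_pos.2 (Real.log_neg hy0 hy1)
  · rcases hs.eq_or_lt with rfl | hs
    · simp [hφ₀.map_zero]
    rw [← hmom s hs, integral_map hlog.aemeasurable (by
      exact (by fun_prop : Continuous fun u : ℝ => Complex.exp (-(s * u : ℝ))).aestronglyMeasurable),
      ← integral_complex_ofReal]
    refine integral_congr_ae ?_
    filter_upwards [hzero] with y h0
    have hy0 : 0 < (y : ℝ) := lt_of_le_of_ne y.2.1 fun h => h0 (Subtype.ext h.symm)
    rw [Real.rpow_def_of_pos hy0]
    push_cast
    congr 1
    ring

end Schoenberg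

section Generator

/-- The centred Gaussian density on `ℝ^d` with covariance `2u` times the identity, as a function of
`u` and `x`. -/
noncomputable def mixtureKernel (d : ℕ) (p : ℝ × EuclideanSpace ℝ (Fin d)) : ℝ :=
  (4 * Real.pi) ^ (-(d / 2) : ℝ) * (p.1 ^ (-(d / 2) : ℝ) * Real.exp (-(‖p.2‖ ^ 2 / (4 * p.1))))

lemma measurable_mixtureKernel (d : ℕ) : Measurable (mixtureKernel d) := by
  unfold mixtureKernel
  fun_prop

lemma mixtureKernel_nonneg {d : ℕ} {u : ℝ} (hu : 0 < u) (x : EuclideanSpace ℝ (Fin d)) :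
    0 ≤ mixtureKernel d (u, x) := by
  unfold mixtureKernel
  positivity

lemma integral_mixtureKernel_mul_cexp {d : ℕ} {u : ℝ} (hu : 0 < u)
    (t : EuclideanSpace ℝ (Fin d)) :
    ∫ x, (mixtureKernel d (u, x) : ℂ) * Complex.exp (inner ℝ x t * Complex.I)
      = Complex.exp (-(‖t‖ ^ 2 * u : ℝ)) := by
  have hb : 0 < (((4 * u)⁻¹ : ℝ) : ℂ).re := by
    rw [Complex.ofReal_re]; positivity
  have h := GaussianFourier.integral_cexp_neg_mul_sq_norm_add hb Complex.I t
  have h1 : ∀ x : EuclideanSpace ℝ (Fin d),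
      (mixtureKernel d (u, x) : ℂ) * Complex.exp (inner ℝ x t * Complex.I)
      = (((4 * Real.pi * u) ^ (-(d / 2) : ℝ) : ℝ) : ℂ) * Complex.exp
        (-(((4 * u)⁻¹ : ℝ) : ℂ) * ‖x‖ ^ 2 + Complex.I * inner ℝ t x) := fun x => by
    rw [mixtureKernel, Real.mul_rpow (by positivity : 0 ≤ 4 * Real.pi) hu.le, Complex.exp_add,
      real_inner_comm t x, mul_comm Complex.I]
    push_cast
    rw [neg_mul, show ((‖x‖ : ℝ) : ℂ) ^ 2 / (4 * u) = (4 * (u : ℂ))⁻¹ * ‖x‖ ^ 2 by ring]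
    ring
  simp_rw [h1]
  rw [integral_const_mul, h, ← mul_assoc]
  have h2 : (((4 * Real.pi * u) ^ (-(d / 2) : ℝ) : ℝ) : ℂ) *
      (Real.pi / (((4 * u)⁻¹ : ℝ) : ℂ)) ^
        (Module.finrank ℝ (EuclideanSpace ℝ (Fin d)) / 2 : ℂ) = 1 := by
    have h3 : (Real.pi / (((4 * u)⁻¹ : ℝ) : ℂ)) ^
        (Module.finrank ℝ (EuclideanSpace ℝ (Fin d)) / 2 : ℂ)
        = (((4 * Real.pi * u) ^ (d / 2 : ℝ) : ℝ) : ℂ) := by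
      rw [Complex.ofReal_cpow (by positivity), finrank_euclideanSpace_fin]
      push_cast
      congr 1
      rw [div_inv_eq_mul]
      ring
    rw [h3, ← Complex.ofReal_mul, ← Real.rpow_add (by positivity)]
    simp
  rw [h2, one_mul]
  congr 1
  push_cast
  rw [Complex.I_sq]
  have : (u : ℂ) ≠ 0 := by exact_mod_cast hu.ne'
  field_simp

lemma integral_mixtureKernel {d : ℕ} {u : ℝ} (hu : 0 < u) :
    ∫ x, mixtureKernel d (u, x) = 1 := by
  have := integral_mixtureKernel_mul_cexp hu (0 : EuclideanSpace ℝ (Fin d))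
  simp only [inner_zero_right, Complex.ofReal_zero, zero_mul, Complex.exp_zero, mul_one,
    norm_zero, ne_eq, OfNat.ofNat_ne_zero, not_false_eq_true, zero_pow, neg_zero] at this
  rw [integral_complex_ofReal] at this
  exact_mod_cast this

lemma lintegral_mixtureKernel {d : ℕ} {u : ℝ} (hu : 0 < u) :
    ∫⁻ x, ENNReal.ofReal (mixtureKernel d (u, x)) = 1 := by
  have hint : Integrable fun x => mixtureKernel d (u, x) := by
    by_contra h
    simpa [integral_undef h] using integral_mixtureKernel (d := d) hu
  rw [← ofReal_integral_eq_lintegral_ofReal hint (.of_forall (mixtureKernel_nonneg hu)),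
    integral_mixtureKernel hu, ENNReal.ofReal_one]

/-- An elliptical family has a decreasing density generator in every dimension. -/
theorem exists_isDensityGenerator {φ₀ : ℝ → ℂ} (hφ₀ : IsEllipticalFamily φ₀) (d : ℕ) :
    ∃ f : ℝ → ℝ≥0∞, IsDensityGenerator d φ₀ f := by
  obtain ⟨ν, hν, hpos, hφ⟩ := exists_laplace_measure hφ₀
  let E := EuclideanSpace ℝ (Fin d)
  let f : ℝ → ℝ≥0∞ := fun y =>
    ∫⁻ u, ENNReal.ofReal (u ^ (-(d / 2) : ℝ) * Real.exp (-(y / (4 * u)))) ∂ν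
  let k : ℝ≥0∞ := ENNReal.ofReal ((4 * Real.pi) ^ (-(d / 2) : ℝ))
  let κ : ℝ × E → ℝ≥0∞ := fun p => ENNReal.ofReal (mixtureKernel d p)
  have hκ : Measurable κ := (measurable_mixtureKernel d).ennreal_ofReal
  have hκ1 : ∫⁻ p, κ p ∂(ν.prod volume) = 1 := by
    rw [lintegral_prod _ hκ.aemeasurable, lintegral_congr_ae (g := fun _ => 1), lintegral_one,
      measure_univ]
    filter_upwards [hpos] with u hu using lintegral_mixtureKernel hu
  have hkf : ∀ x : E, k * f (‖x‖ ^ 2) = ∫⁻ u, κ (u, x) ∂ν := fun x => by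
    rw [← lintegral_const_mul' _ _ ENNReal.ofReal_ne_top]
    refine lintegral_congr fun u => ?_
    simp only [κ, mixtureKernel]
    rw [← ENNReal.ofReal_mul (by positivity)]
  let Q : Measure E := volume.withDensity fun x => k * f (‖x‖ ^ 2)
  have hQmap : Q = ((ν.prod volume).withDensity κ).map Prod.snd := by
    ext A hA
    rw [Measure.map_apply measurable_snd hA, withDensity_apply _ hA,
      withDensity_apply _ (measurable_snd hA), ← lintegral_indicator (measurable_snd hA),
      lintegral_prod_symm _ (hκ.indicator (measurable_snd hA)).aemeasurable,
      ← lintegral_indicator hA]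
    refine lintegral_congr fun x => ?_
    by_cases hx : x ∈ A <;> simp [Set.indicator, hx, hkf]
  have hprob : IsProbabilityMeasure Q := by
    constructor
    rw [hQmap, Measure.map_apply measurable_snd MeasurableSet.univ, Set.preimage_univ,
      withDensity_apply _ MeasurableSet.univ, Measure.restrict_univ, hκ1]
  have hnonneg : ∀ᵐ p ∂(ν.prod (volume : Measure E)), 0 ≤ mixtureKernel d p := by
    have : ∀ᵐ p ∂(ν.prod (volume : Measure E)), 0 < p.1 :=
      Measure.quasiMeasurePreserving_fst.ae hpos
    filter_upwards [this] with p hp using mixtureKernel_nonneg hp p.2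
  refine ⟨f, ?_, ?_, Q, hprob, fun t => ?_, k, ?_, ENNReal.ofReal_ne_top, rfl⟩
  · intro y hy z hz hyz
    refine lintegral_mono_ae ?_
    filter_upwards [hpos] with u hu
    gcongr
  · intro y hy
    rw [pos_iff_ne_zero]
    intro h0
    have h1 := (lintegral_eq_zero_iff (by fun_prop)).1 h0
    have h2 : ∀ᵐ u ∂ν, False := by
      filter_upwards [h1, hpos] with u hu hu0
      have : 0 < u ^ (-(d / 2) : ℝ) * Real.exp (-(y / (4 * u))) := by positivity
      simp only [Pi.zero_apply, ENNReal.ofReal_eq_zero] at hu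
      linarith
    exact IsProbabilityMeasure.ne_zero ν (by simpa using h2)
  · rw [charFun_apply, hQmap, integral_map measurable_snd.aemeasurable
      (by exact (by fun_prop : Continuous fun x : E =>
        Complex.exp (inner ℝ x t * Complex.I)).aestronglyMeasurable),
      integral_withDensity_eq_integral_toReal_smul hκ (.of_forall fun _ => ENNReal.ofReal_lt_top)]
    have hcongr : ∫ p, (κ p).toReal • Complex.exp (inner ℝ p.2 t * Complex.I) ∂(ν.prod volume)
        = ∫ p, (mixtureKernel d p : ℂ) * Complex.exp (inner ℝ p.2 t * Complex.I)
            ∂(ν.prod volume) := by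
      refine integral_congr_ae ?_
      filter_upwards [hnonneg] with p hp
      simp only [κ]
      rw [ENNReal.toReal_ofReal hp, Complex.real_smul]
    have hint : Integrable (mixtureKernel d) (ν.prod volume) := by
      refine ⟨(measurable_mixtureKernel d).aestronglyMeasurable, ?_⟩
      rw [hasFiniteIntegral_iff_ofReal hnonneg]
      exact hκ1.trans_lt ENNReal.one_lt_top
    rw [hcongr, integral_prod]
    · rw [← hφ _ (by positivity)]
      refine integral_congr_ae ?_
      filter_upwards [hpos] with u hu using integral_mixtureKernel_mul_cexp hu t
    · refine Integrable.mono' hint.norm ?_ (.of_forall fun p => ?_)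
      · exact ((Complex.measurable_ofReal.comp (measurable_mixtureKernel d)).mul
          (by fun_prop)).aestronglyMeasurable
      · rw [norm_mul, Complex.norm_exp_ofReal_mul_I, mul_one, Complex.norm_real]
  · simp only [k, ne_eq, ENNReal.ofReal_eq_zero, not_le]
    positivity

end Generator

section Versions

variable {X : Type*} [AddCommGroup X] [Module ℝ X] [TopologicalSpace X]
  [IsTopologicalAddGroup X] [ContinuousSMul ℝ X] {C : DispersionForm X}

/-- The canonical map from the dual to `𝒦`, as a linear map. -/
noncomputable def toKₗ (C : DispersionForm X) : (X →L[ℝ] ℝ) →ₗ[ℝ] K C :=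
  (UniformSpace.Completion.toComplₗᵢ (𝕜 := ℝ) (E := PreK C)).toLinearMap ∘ₗ
    (toPreK C).toLinearMap

lemma toKₗ_apply (g : X →L[ℝ] ℝ) : toKₗ C g = toK C g := rfl

lemma norm_toK_sq (g : X →L[ℝ] ℝ) : ‖toK C g‖ ^ 2 = C.form g g := by
  rw [toK, UniformSpace.Completion.norm_coe, ← real_inner_self_eq_norm_sq]
  rfl

lemma denseRange_toK : DenseRange (toK C) :=
  (UniformSpace.Completion.denseRange_coe (α := PreK C)).comp
    (toPreK C).surjective.denseRange (UniformSpace.Completion.continuous_coe _)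

/-- The element of `𝒦` representing a Cameron–Martin vector is unique. -/
lemma IsImage.unique {k k' : K C} {h : X} (hk : IsImage C k h) (hk' : IsImage C k' h) : k = k' := by
  have h1 : (fun y : K C => inner ℝ k y) = fun y => inner ℝ k' y :=
    denseRange_toK.equalizer (by fun_prop) (by fun_prop) (funext fun g => by
      simp only [Function.comp_apply]; rw [← hk g, ← hk' g])
  exact ext_inner_right ℝ fun y => congrFun h1 y

lemma IsImage.cmNorm_eq {k : K C} {h : X} (hk : IsImage C k h) : cmNorm C h = ‖k‖ₑ :=
  le_antisymm (iInf₂_le k hk) (le_iInf₂ fun k' hk' => by rw [hk.unique hk'])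

/-- Differences of the summary at neighbouring databases are Cameron–Martin vectors, of norm at most
the sensitivity. -/
lemma exists_isImage_of_dist_le {𝓓 : Type*} [MetricSpace 𝓓] {T : 𝓓 → X}
    (hT : sensitivity C T < ⊤) {D D' : 𝓓} (hD : dist D D' ≤ 1) :
    ∃ k : K C, IsImage C k (T D - T D') ∧ ‖k‖ ≤ (sensitivity C T).toReal := by
  have hle : cmNorm C (T D - T D') ≤ sensitivity C T :=
    le_iSup_of_le D (le_iSup_of_le D' (le_iSup_of_le hD le_rfl))
  have hlt := hle.trans_lt hT
  obtain ⟨k, hk⟩ := iInf_lt_iff.1 hlt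
  obtain ⟨hk, -⟩ := iInf_lt_iff.1 hk
  refine ⟨k, hk, ?_⟩
  rw [hk.cmNorm_eq] at hle
  simpa using ENNReal.toReal_mono hT.ne hle

variable [MeasurableSpace X] {P : Measure X} {φ₀ : ℝ → ℂ}

lemma integral_cexp_eq_generator (hP : IsElliptical P 0 C φ₀) (g : X →L[ℝ] ℝ) :
    ∫ x, Complex.exp (Complex.I * (g x : ℂ)) ∂P = φ₀ (‖toK C g‖ ^ 2) := by
  rw [hP.2 g, norm_toK_sq]
  simp

section Domain

variable {g : K C}

lemma Version.tendsto_eval (v : Version C P g) {x : X} (hx : x ∈ v.domain) :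
    Tendsto (fun n => v.seq n x) atTop (𝓝 (v.eval x)) :=
  tendsto_nhds_limUnder hx

lemma Version.eval_eq (v : Version C P g) {x : X} {l : ℝ}
    (h : Tendsto (fun n => v.seq n x) atTop (𝓝 l)) : v.eval x = l :=
  h.limUnder_eq

lemma Version.ae_mem_domain (v : Version C P g) : ∀ᵐ x ∂P, x ∈ v.domain := v.ae_converges

lemma Version.eval_add_smul (v : Version C P g) {x y : X} (hx : x ∈ v.domain) (hy : y ∈ v.domain)
    (c : ℝ) : v.eval (x + c • y) = v.eval x + c * v.eval y :=
  v.eval_eq (by simpa using (v.tendsto_eval hx).add ((v.tendsto_eval hy).const_mul c))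

lemma Version.tendsto_of_isImage (v : Version C P g) {k : K C} {h : X} (hk : IsImage C k h) :
    Tendsto (fun n => v.seq n h) atTop (𝓝 (inner ℝ k g)) :=
  (tendsto_const_nhds.inner v.tendsto_seq).congr fun n => (hk (v.seq n)).symm

lemma Version.eval_of_isImage (v : Version C P g) {k : K C} {h : X} (hk : IsImage C k h) :
    h ∈ v.domain ∧ v.eval h = inner ℝ k g :=
  ⟨⟨_, v.tendsto_of_isImage hk⟩, v.eval_eq (v.tendsto_of_isImage hk)⟩

end Domain

variable [BorelSpace X]

lemma Version.measurable_eval {g : K C} (v : Version C P g) : Measurable v.eval :=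
  (StronglyMeasurable.limUnder fun n => (v.seq n).continuous.measurable.stronglyMeasurable).measurable

/-- The characteristic functional of `P` extends to almost everywhere limits of functionals which
converge in `𝒦`. -/
lemma integral_cexp_of_tendsto (hφ₀ : IsEllipticalFamily φ₀) (hP : IsElliptical P 0 C φ₀)
    {s : ℕ → X →L[ℝ] ℝ} {g : K C} (hs : Tendsto (fun n => toK C (s n)) atTop (𝓝 g)) {F : X → ℝ}
    (hF : ∀ᵐ x ∂P, Tendsto (fun n => s n x) atTop (𝓝 (F x))) :
    ∫ x, Complex.exp (Complex.I * (F x : ℂ)) ∂P = φ₀ (‖g‖ ^ 2) := by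
  have := hP.1
  have h1 : Tendsto (fun n => φ₀ (‖toK C (s n)‖ ^ 2)) atTop (𝓝 (φ₀ (‖g‖ ^ 2))) :=
    (hφ₀.continuousOn _ (Set.mem_Ici.2 (by positivity))).tendsto.comp
      (tendsto_nhdsWithin_iff.2 ⟨hs.norm.pow 2, .of_forall fun n => Set.mem_Ici.2 (by positivity)⟩)
  refine tendsto_nhds_unique ?_ h1
  simp_rw [← integral_cexp_eq_generator hP]
  refine tendsto_integral_of_dominated_convergence (fun _ => 1) (fun n => ?_)
    (integrable_const _) (fun n => .of_forall fun x => ?_) ?_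
  · have := (s n).continuous
    exact (by fun_prop : Measurable fun x => Complex.exp (Complex.I * (s n x : ℂ))).aestronglyMeasurable
  · rw [mul_comm, Complex.norm_exp_ofReal_mul_I]
  · filter_upwards [hF] with x hx
    exact ((by fun_prop : Continuous fun r : ℝ => Complex.exp (Complex.I * (r : ℂ))).tendsto _).comp hx

lemma Version.eval_ae_eq (hφ₀ : IsEllipticalFamily φ₀) (hP : IsElliptical P 0 C φ₀) {g : K C}
    (v w : Version C P g) : v.eval =ᵐ[P] w.eval := by
  have := hP.1
  have hm : Measurable fun x => v.eval x - w.eval x := v.measurable_eval.sub w.measurable_eval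
  have hprob := Measure.isProbabilityMeasure_map (μ := P) hm.aemeasurable
  have hlaw : P.map (fun x => v.eval x - w.eval x) = Measure.dirac 0 := by
    refine Measure.ext_of_charFun (funext fun t => ?_)
    rw [charFun_apply_real, integral_map hm.aemeasurable (by
      exact (by fun_prop : Continuous fun x : ℝ =>
        Complex.exp (t * x * Complex.I)).aestronglyMeasurable), charFun_dirac]
    have h0 : Tendsto (fun n => toK C (t • (v.seq n - w.seq n))) atTop (𝓝 0) := by
      simp_rw [← toKₗ_apply, map_smul, map_sub, toKₗ_apply]
      simpa using (v.tendsto_seq.sub w.tendsto_seq).const_smul t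
    have h1 := integral_cexp_of_tendsto hφ₀ hP h0 (F := fun x => t * (v.eval x - w.eval x)) ?_
    · simp only [norm_zero, ne_eq, OfNat.ofNat_ne_zero, not_false_eq_true, zero_pow,
        hφ₀.map_zero] at h1
      simp only [inner_zero_left, Complex.ofReal_zero, zero_mul, Complex.exp_zero]
      rw [← h1]
      refine integral_congr_ae (.of_forall fun x => ?_)
      push_cast
      ring_nf
    · filter_upwards [v.ae_mem_domain, w.ae_mem_domain] with x hv hw
      simpa using ((v.tendsto_eval hv).sub (w.tendsto_eval hw)).const_mul t
  have h2 : ∀ᵐ y ∂(P.map fun x => v.eval x - w.eval x), y = 0 := by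
    rw [hlaw]
    simp [ae_dirac_eq]
  filter_upwards [ae_of_ae_map hm.aemeasurable h2] with x hx using sub_eq_zero.1 hx

/-- Functionals which are small in `𝒦` are small in probability. -/
lemma exists_forall_measureReal_abs_gt_le (hφ₀ : IsEllipticalFamily φ₀)
    (hP : IsElliptical P 0 C φ₀) {ε : ℝ} (hε : 0 < ε) :
    ∃ δ > 0, ∀ g : X →L[ℝ] ℝ, ‖toK C g‖ < δ → P.real {x | ε < |g x|} ≤ ε := by
  have := hP.1
  obtain ⟨η, hη, hφ⟩ : ∃ η > 0, ∀ s, 0 ≤ s → s < η → ‖1 - φ₀ s‖ ≤ ε / 2 := by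
    have h := Metric.continuousWithinAt_iff.1
      (hφ₀.continuousOn 0 (Set.mem_Ici.2 le_rfl)) (ε / 2) (by positivity)
    obtain ⟨η, hη, h⟩ := h
    refine ⟨η, hη, fun s hs hsη => ?_⟩
    have := h (Set.mem_Ici.2 hs) (by rwa [Real.dist_0_eq_abs, abs_of_nonneg hs])
    rw [hφ₀.map_zero, dist_comm, dist_eq_norm] at this
    exact this.le
  refine ⟨√η * ε / 2, by positivity, fun g hg => ?_⟩
  have hgm : Measurable g := g.continuous.measurable
  have hprob := Measure.isProbabilityMeasure_map (μ := P) hgm.aemeasurable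
  have hchar : ∀ t, charFun (P.map g) t = φ₀ (t ^ 2 * ‖toK C g‖ ^ 2) := fun t => by
    have h1 := integral_cexp_eq_generator hP (t • g)
    rw [← toKₗ_apply, map_smul, toKₗ_apply, norm_smul, mul_pow, Real.norm_eq_abs, sq_abs] at h1
    rw [← h1, charFun_apply_real, integral_map hgm.aemeasurable (by
      exact (by fun_prop : Continuous fun x : ℝ =>
        Complex.exp (t * x * Complex.I)).aestronglyMeasurable)]
    refine integral_congr_ae (.of_forall fun x => ?_)
    simp only [_root_.smul_apply, smul_eq_mul]
    push_cast
    ring_nf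
  have h2 := measureReal_abs_gt_le_integral_charFun (μ := P.map g) hε
  have h3 : P.real {x | ε < |g x|} = (P.map g).real {x | ε < |x|} := by
    rw [map_measureReal_apply hgm (measurableSet_lt measurable_const (by fun_prop))]
    rfl
  have h4 : ‖∫ t in (-2 * ε⁻¹)..(2 * ε⁻¹), 1 - charFun (P.map g) t‖
      ≤ ε / 2 * |2 * ε⁻¹ - -2 * ε⁻¹| := by
    refine intervalIntegral.norm_integral_le_of_norm_le_const fun t ht => ?_
    rw [hchar]
    refine hφ _ (by positivity) ?_
    have ht' : |t| ≤ 2 * ε⁻¹ := by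
      rw [Set.uIoc_of_le (by have := inv_pos.2 hε; linarith)] at ht
      exact abs_le.2 ⟨by linarith [ht.1], ht.2⟩
    have h5 : |t| * ‖toK C g‖ < √η := by
      calc |t| * ‖toK C g‖ ≤ 2 * ε⁻¹ * ‖toK C g‖ := by gcongr
        _ < 2 * ε⁻¹ * (√η * ε / 2) := by gcongr
        _ = √η := by field_simp
    calc t ^ 2 * ‖toK C g‖ ^ 2 = (|t| * ‖toK C g‖) ^ 2 := by rw [mul_pow, sq_abs]
      _ < √η ^ 2 := by gcongr
      _ = η := Real.sq_sqrt hη.le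
  rw [h3]
  refine h2.trans ?_
  calc 2⁻¹ * ε * ‖∫ t in (-2 * ε⁻¹)..(2 * ε⁻¹), 1 - charFun (P.map g) t‖
      ≤ 2⁻¹ * ε * (ε / 2 * |2 * ε⁻¹ - -2 * ε⁻¹|) := by gcongr
    _ = ε := by
      rw [abs_of_pos (by have := inv_pos.2 hε; linarith)]
      field_simp
      norm_num

theorem nonempty_version (hφ₀ : IsEllipticalFamily φ₀) (hP : IsElliptical P 0 C φ₀) (g : K C) :
    Nonempty (Version C P g) := by
  have := hP.1
  obtain ⟨u, hu⟩ : ∃ u : ℕ → X →L[ℝ] ℝ, Tendsto (fun n => toK C (u n)) atTop (𝓝 g) := by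
    have hg : g ∈ closure (Set.range (toK C)) := denseRange_toK g
    obtain ⟨y, hy, hlim⟩ := mem_closure_iff_seq_limit.1 hg
    choose u hu using hy
    exact ⟨u, by simpa only [hu] using hlim⟩
  choose δ hδ hsmall using fun n : ℕ =>
    exists_forall_measureReal_abs_gt_le hφ₀ hP (ε := (1 / 2) ^ n) (by positivity)
  obtain ⟨ψ, hψ, hclose⟩ := hu.cauchySeq.subseq_mem (fun n => Metric.dist_mem_uniformity (hδ n))
  refine ⟨⟨fun n => u (ψ n), hu.comp hψ.tendsto_atTop, ?_⟩⟩
  have hmeas : ∀ n, P {x | (1 / 2 : ℝ) ^ n < |u (ψ (n + 1)) x - u (ψ n) x|}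
      ≤ ENNReal.ofReal ((1 / 2) ^ n) := fun n => by
    have h1 := hsmall n (u (ψ (n + 1)) - u (ψ n)) (by
      rw [← toKₗ_apply, map_sub, toKₗ_apply, toKₗ_apply, ← dist_eq_norm]
      exact hclose n)
    rw [measureReal_def] at h1
    exact (ENNReal.le_ofReal_iff_toReal_le (measure_ne_top _ _) (by positivity)).2 h1
  have hsum : ∑' n, P {x | (1 / 2 : ℝ) ^ n < |u (ψ (n + 1)) x - u (ψ n) x|} ≠ ∞ := by
    refine ne_top_of_le_ne_top ?_ (ENNReal.tsum_le_tsum hmeas)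
    rw [← ENNReal.ofReal_tsum_of_nonneg (fun n => by positivity) summable_geometric_two]
    exact ENNReal.ofReal_ne_top
  filter_upwards [ae_eventually_notMem hsum] with x hx
  refine cauchySeq_tendsto_of_complete (cauchySeq_of_summable_dist ?_)
  refine Summable.of_norm_bounded_eventually_nat summable_geometric_two ?_
  filter_upwards [hx] with n hn
  rw [dist_comm, Real.dist_eq, Real.norm_eq_abs, abs_abs]
  exact not_lt.1 hn

end Versions

section Projections

/-- Finitely many vectors of an inner product space can be moved isometrically to a Euclidean space,
by a contraction defined on the whole space. -/
lemma exists_contraction_euclideanSpace {H : Type*} [NormedAddCommGroup H] [InnerProductSpace ℝ H]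
    {d : ℕ} (g : Fin d → H) :
    ∃ L : H →ₗ[ℝ] EuclideanSpace ℝ (Fin d),
      (∀ i k, inner ℝ (L (g i)) (L k) = inner ℝ (g i) k) ∧ ∀ k, ‖L k‖ ≤ ‖k‖ := by
  let S : Submodule ℝ H := Submodule.span ℝ (Set.range g)
  have hfin : FiniteDimensional ℝ S := FiniteDimensional.span_of_finite ℝ (Set.finite_range g)
  have hr : Module.finrank ℝ S ≤ d := (finrank_range_le_card g).trans_eq (Fintype.card_fin d)
  let b := stdOrthonormalBasis ℝ S
  let c : Fin (Module.finrank ℝ S) → EuclideanSpace ℝ (Fin d) :=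
    fun j => EuclideanSpace.basisFun (Fin d) ℝ (Fin.castLE hr j)
  have hc : Orthonormal ℝ c :=
    (EuclideanSpace.basisFun (Fin d) ℝ).orthonormal.comp _ (Fin.castLE_injective hr)
  let J : S →ₗᵢ[ℝ] EuclideanSpace ℝ (Fin d) :=
    (b.toBasis.constr ℝ c).isometryOfOrthonormal (v := b.toBasis) (by simp) (by
      convert hc using 1
      funext j
      simp)
  refine ⟨J.toLinearMap ∘ₗ S.orthogonalProjectionOnto.toLinearMap, fun i k => ?_, fun k => ?_⟩
  · have hi : g i ∈ S := Submodule.subset_span ⟨i, rfl⟩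
    simp only [LinearMap.comp_apply, LinearIsometry.coe_toLinearMap, ContinuousLinearMap.coe_coe,
      J.inner_map_map]
    rw [Submodule.orthogonalProjectionOnto_mem_subspace_eq_self (⟨g i, hi⟩ : S)]
    exact Submodule.inner_orthogonalProjectionOnto_eq_of_mem_left (⟨g i, hi⟩ : S) k
  · simp only [LinearMap.comp_apply, LinearIsometry.coe_toLinearMap, ContinuousLinearMap.coe_coe,
      J.norm_map]
    exact S.norm_orthogonalProjectionOnto_apply_le k

variable {X : Type*} [AddCommGroup X] [Module ℝ X] [TopologicalSpace X]
  [IsTopologicalAddGroup X] [ContinuousSMul ℝ X] {C : DispersionForm X}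
  [MeasurableSpace X] [BorelSpace X] {P : Measure X} {φ₀ : ℝ → ℂ} {d : ℕ}

/-- The joint law of versions of elements of `𝒦` is a linear image of the standard elliptical
measure. -/
lemma map_eval_eq_map_inner (hφ₀ : IsEllipticalFamily φ₀) (hP : IsElliptical P 0 C φ₀)
    {Q : Measure (EuclideanSpace ℝ (Fin d))} [IsProbabilityMeasure Q]
    (hQ : ∀ t, charFun Q t = φ₀ (‖t‖ ^ 2)) {g : Fin d → K C} (v : ∀ i, Version C P (g i))
    {a : Fin d → EuclideanSpace ℝ (Fin d)}
    (ha : ∀ i j, inner ℝ (a i) (a j) = inner ℝ (g i) (g j)) :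
    P.map (fun x i => (v i).eval x) = Q.map fun z i => inner ℝ (a i) z := by
  have := hP.1
  have hV : Measurable fun x i => (v i).eval x := measurable_pi_lambda _ fun i => (v i).measurable_eval
  have hA : Measurable fun (z : EuclideanSpace ℝ (Fin d)) i => inner ℝ (a i) z := by fun_prop
  have hL : Measurable (WithLp.toLp 2 : (Fin d → ℝ) → EuclideanSpace ℝ (Fin d)) :=
    WithLp.measurable_toLp 2 _
  have h1 := Measure.isProbabilityMeasure_map (μ := P) (hL.comp hV).aemeasurable
  have h2 := Measure.isProbabilityMeasure_map (μ := Q) (hL.comp hA).aemeasurable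
  have key : P.map (WithLp.toLp 2 ∘ fun x i => (v i).eval x)
      = Q.map (WithLp.toLp 2 ∘ fun z i => inner ℝ (a i) z) := by
    refine Measure.ext_of_charFun (funext fun t => ?_)
    have hc : Continuous fun x : EuclideanSpace ℝ (Fin d) =>
        Complex.exp (inner ℝ x t * Complex.I) := by fun_prop
    rw [charFun_apply, charFun_apply,
      integral_map (hL.comp hV).aemeasurable hc.aestronglyMeasurable,
      integral_map (hL.comp hA).aemeasurable hc.aestronglyMeasurable]
    have hlhs := integral_cexp_of_tendsto hφ₀ hP
      (s := fun n => ∑ i, t i • (v i).seq n) (g := ∑ i, t i • g i)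
      (F := fun x => ∑ i, t i * (v i).eval x) ?_ ?_
    · have hrhs := hQ (∑ i, t i • a i)
      have hnorm : ‖∑ i, t i • a i‖ ^ 2 = ‖∑ i, t i • g i‖ ^ 2 := by
        simp_rw [← real_inner_self_eq_norm_sq, sum_inner, inner_sum, real_inner_smul_left,
          real_inner_smul_right, ha]
      rw [hnorm, ← hlhs, charFun_apply] at hrhs
      convert hrhs.symm using 3 with x z
      · simp [PiLp.inner_apply, mul_comm Complex.I]
      · have hz : inner ℝ z (∑ i, t i • a i) = ∑ i, t i * inner ℝ (a i) z := by
          simp_rw [inner_sum, real_inner_smul_right, real_inner_comm]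
        rw [hz, Function.comp_apply, PiLp.inner_apply]
        simp only [RCLike.inner_apply, conj_trivial]
    · simp_rw [← toKₗ_apply, map_sum, map_smul, toKₗ_apply]
      exact tendsto_finsetSum _ fun i _ => (v i).tendsto_seq.const_smul (t i)
    · filter_upwards [ae_all_iff.2 fun i => (v i).ae_mem_domain] with x hx
      simp only [_root_.sum_apply, _root_.smul_apply, smul_eq_mul]
      exact tendsto_finsetSum _ fun i _ => ((v i).tendsto_eval (hx i)).const_mul (t i)
  have hL' : Measurable (WithLp.ofLp : EuclideanSpace ℝ (Fin d) → Fin d → ℝ) :=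
    WithLp.measurable_ofLp 2 _
  have h3 := congrArg (Measure.map WithLp.ofLp) key
  rwa [Measure.map_map hL' (hL.comp hV), Measure.map_map hL' (hL.comp hA)] at h3

/-- The projections of the sanitized summary are an affine image of the standard elliptical
measure. -/
lemma map_mechanism_eq (hφ₀ : IsEllipticalFamily φ₀) (hP : IsElliptical P 0 C φ₀)
    {Q : Measure (EuclideanSpace ℝ (Fin d))} [IsProbabilityMeasure Q]
    (hQ : ∀ t, charFun Q t = φ₀ (‖t‖ ^ 2)) {g : Fin d → K C} (v : ∀ i, Version C P (g i))
    {a : Fin d → EuclideanSpace ℝ (Fin d)}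
    (ha : ∀ i j, inner ℝ (a i) (a j) = inner ℝ (g i) (g j)) (σ : ℝ) {t : X}
    (ht : ∀ i, t ∈ (v i).domain) :
    (mechanism P σ t).map (fun y i => (v i).eval y)
      = Q.map fun z i => (v i).eval t + σ * inner ℝ (a i) z := by
  have hV : Measurable fun x i => (v i).eval x := measurable_pi_lambda _ fun i => (v i).measurable_eval
  have hm : Measurable fun x : X => t + σ • x := (by fun_prop : Continuous _).measurable
  have hS : Measurable fun (y : Fin d → ℝ) i => (v i).eval t + σ * y i := by fun_prop
  have h1 := congrArg (Measure.map fun y i => (v i).eval t + σ * y i)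
    (map_eval_eq_map_inner hφ₀ hP hQ v ha)
  rw [Measure.map_map hS hV, Measure.map_map hS (by fun_prop)] at h1
  rw [mechanism, Measure.map_map hV hm]
  refine Eq.trans (Measure.map_congr ?_) h1
  filter_upwards [ae_all_iff.2 fun i => (v i).ae_mem_domain] with x hx
  funext i
  exact (v i).eval_add_smul (ht i) (hx i) σ

end Projections

section Density

lemma map_withDensity_comp {α β : Type*} [MeasurableSpace α] [MeasurableSpace β] (μ : Measure α)
    {Φ : α → β} (hΦ : Measurable Φ) {ρ : β → ℝ≥0∞} (hρ : Measurable ρ) :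
    (μ.withDensity fun x => ρ (Φ x)).map Φ = (μ.map Φ).withDensity ρ := by
  ext A hA
  rw [Measure.map_apply hΦ hA, withDensity_apply _ (hΦ hA), withDensity_apply _ hA,
    setLIntegral_map hA hρ hΦ]

variable {d : ℕ} {f : ℝ → ℝ≥0∞}

lemma measurable_comp_of_antitoneOn (hf : AntitoneOn f (Set.Ici 0)) {α : Type*} [MeasurableSpace α]
    {q : α → ℝ} (hq : Measurable q) (hq0 : ∀ x, 0 ≤ q x) : Measurable fun x => f (q x) := by
  have h1 : Antitone fun s => f (max s 0) := fun s t hst =>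
    hf (Set.mem_Ici.2 (le_max_right _ _)) (Set.mem_Ici.2 (le_max_right _ _)) (max_le_max_right 0 hst)
  have h2 := h1.measurable.comp hq
  refine (congrArg Measurable (funext fun x => ?_)).mp h2
  simp [max_eq_left (hq0 x)]

open Matrix in
/-- An invertible affine image of a spherical measure with density generator `f` has the
corresponding elliptical density. -/
lemma map_affine_withDensity (hf : AntitoneOn f (Set.Ici 0)) (k : ℝ≥0∞)
    (a : Fin d → EuclideanSpace ℝ (Fin d)) (hG : (gram ℝ a).PosDef) {σ : ℝ} (hσ : 0 < σ) :
    ∃ c : ℝ≥0∞, c ≠ 0 ∧ c ≠ ⊤ ∧ ∀ μ : Fin d → ℝ,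
      ((volume : Measure (EuclideanSpace ℝ (Fin d))).withDensity fun x => k * f (‖x‖ ^ 2)).map
          (fun z i => μ i + σ * inner ℝ (a i) z)
        = (volume : Measure (Fin d → ℝ)).withDensity fun x =>
          c * (k * f (σ⁻¹ ^ 2 * ((x - μ) ⬝ᵥ ((gram ℝ a)⁻¹.mulVec (x - μ))))) := by
  let M : Matrix (Fin d) (Fin d) ℝ := Matrix.of fun i j => a i j
  have hMG : M * Mᵀ = gram ℝ a := by
    ext i j
    simp [M, Matrix.mul_apply, gram_apply, PiLp.inner_apply, mul_comm]
  have hdet : M.det ≠ 0 := fun h0 => hG.det_pos.ne' (by rw [← hMG, Matrix.det_mul, h0, zero_mul])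
  have hdet' : (σ • M).det ≠ 0 := by
    rw [Matrix.det_smul]; positivity
  refine ⟨ENNReal.ofReal |(σ • M).det⁻¹|, ?_, ENNReal.ofReal_ne_top, fun μ => ?_⟩
  · simp only [ne_eq, ENNReal.ofReal_eq_zero, not_le]
    positivity
  let Φ : EuclideanSpace ℝ (Fin d) → Fin d → ℝ := fun z i => μ i + σ * inner ℝ (a i) z
  have hΦ : Measurable Φ := by fun_prop
  have hΦM : ∀ z, Φ z = μ + (σ • M).mulVec (WithLp.ofLp z) := fun z => by
    funext i
    simp only [Φ, Pi.add_apply, Matrix.smul_mulVec, Pi.smul_apply, smul_eq_mul]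
    simp [M, Matrix.mulVec, dotProduct, PiLp.inner_apply, mul_comm]
  have hvol : (volume : Measure (EuclideanSpace ℝ (Fin d))).map Φ
      = ENNReal.ofReal |(σ • M).det⁻¹| • (volume : Measure (Fin d → ℝ)) := by
    have h1 : Φ = (fun y => μ + y) ∘ (Matrix.toLin' (σ • M)) ∘ WithLp.ofLp := funext hΦM
    have hlin : Measurable (Matrix.toLin' (σ • M)) :=
      (LinearMap.continuous_of_finiteDimensional _).measurable
    have hof := (EuclideanSpace.volume_preserving_symm_measurableEquiv_toLp (Fin d))
    rw [h1, ← Measure.map_map (by fun_prop) (hlin.comp (WithLp.measurable_ofLp 2 _)),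
      ← Measure.map_map hlin (WithLp.measurable_ofLp 2 _)]
    have h2 : (volume : Measure (EuclideanSpace ℝ (Fin d))).map WithLp.ofLp = volume := hof.map_eq
    rw [h2, Real.map_matrix_volume_pi_eq_smul_volume_pi hdet', Measure.map_smul,
      map_add_left_eq_self]
  let q : (Fin d → ℝ) → ℝ := fun x => σ⁻¹ ^ 2 * ((x - μ) ⬝ᵥ ((gram ℝ a)⁻¹.mulVec (x - μ)))
  have hq : Continuous q := by
    simp only [q, dotProduct, Matrix.mulVec]
    fun_prop
  have hq0 : ∀ x, 0 ≤ q x := fun x =>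
    mul_nonneg (by positivity) (by simpa using hG.inv.posSemidef.dotProduct_mulVec_nonneg (x - μ))
  have hqΦ : ∀ z, q (Φ z) = ‖z‖ ^ 2 := fun z => by
    have h3 : Φ z - μ = (σ • M).mulVec (WithLp.ofLp z) := by rw [hΦM, add_sub_cancel_left]
    simp only [q]
    rw [h3, ← hMG, Matrix.mul_inv_rev, Matrix.smul_mulVec, Matrix.mulVec_smul, dotProduct_smul,
      smul_dotProduct, Matrix.mulVec_mulVec, Matrix.mul_assoc,
      Matrix.nonsing_inv_mul _ (isUnit_iff_ne_zero.2 hdet), Matrix.mul_one, dotProduct_comm,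
      Matrix.dotProduct_mulVec, ← Matrix.mulVec_transpose, Matrix.mulVec_mulVec,
      Matrix.mul_nonsing_inv _ (isUnit_iff_ne_zero.2 (by rwa [Matrix.det_transpose])),
      Matrix.one_mulVec, EuclideanSpace.real_norm_sq_eq]
    simp only [dotProduct, smul_eq_mul, ← pow_two]
    field_simp
  have hρ : Measurable fun x => k * f (q x) :=
    (measurable_comp_of_antitoneOn hf hq.measurable hq0).const_mul k
  have := map_withDensity_comp volume hΦ hρ
  simp only [hqΦ] at this
  rw [this, hvol, withDensity_smul_measure, ← withDensity_smul _ hρ]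
  rfl

end Density

section Privacy

variable {f : ℝ → ℝ≥0∞}

lemma le_mul_of_limsup_lt_top (hf : AntitoneOn f (Set.Ici 0)) (hpos : ∀ y, 0 ≤ y → 0 < f y)
    (h0 : f 0 < ⊤) {Δ : ℝ}
    (hlim : limsup (fun c : ℝ => f ((c - Δ) ^ 2) / f (c ^ 2)) atTop < ⊤) :
    ∃ M : ℝ≥0∞, M ≠ ⊤ ∧ ∃ c₀ : ℝ, ∀ c, c₀ ≤ c → f ((c - Δ) ^ 2) ≤ M * f (c ^ 2) := by
  obtain ⟨M, hM1, hM2⟩ := exists_between hlim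
  obtain ⟨c₀, hc₀⟩ := eventually_atTop.1 (eventually_lt_of_limsup_lt hM1)
  refine ⟨M, hM2.ne, c₀, fun c hc => ?_⟩
  have hfin : f (c ^ 2) ≠ ⊤ :=
    ((hf (Set.mem_Ici.2 le_rfl) (Set.mem_Ici.2 (sq_nonneg c)) (sq_nonneg c)).trans_lt h0).ne
  exact (ENNReal.div_le_iff (hpos _ (sq_nonneg c)).ne' hfin).1 (hc₀ c hc).le

/-- Exponential control of the tail of a density generator for one shift gives it for all multiples
of the shift. -/
lemma le_pow_mul_of_le_mul {Δ c₀ : ℝ} {M : ℝ≥0∞}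
    (h : ∀ c, c₀ ≤ c → f ((c - Δ) ^ 2) ≤ M * f (c ^ 2)) (hΔ : 0 ≤ Δ) (m : ℕ) :
    ∀ c, c₀ + m * Δ ≤ c → f ((c - m * Δ) ^ 2) ≤ M ^ m * f (c ^ 2) := by
  induction m with
  | zero => intro c _; simp
  | succ m ih =>
    intro c hc
    push_cast at hc ⊢
    have h1 := h (c - m * Δ) (by linarith)
    have h2 := ih c (by linarith)
    calc f ((c - (m + 1) * Δ) ^ 2) = f ((c - m * Δ - Δ) ^ 2) := by congr 2; ring
      _ ≤ M * f ((c - m * Δ) ^ 2) := h1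
      _ ≤ M * (M ^ m * f (c ^ 2)) := by gcongr
      _ = M ^ (m + 1) * f (c ^ 2) := by rw [pow_succ' M, mul_assoc]

lemma privacyRatio_lt_top (hf : AntitoneOn f (Set.Ici 0)) (hpos : ∀ y, 0 ≤ y → 0 < f y)
    (h0 : f 0 < ⊤) {Δ : ℝ} (hΔ : 0 ≤ Δ)
    (hlim : limsup (fun c : ℝ => f ((c - Δ) ^ 2) / f (c ^ 2)) atTop < ⊤) {s : ℝ} (hs : 0 ≤ s) :
    privacyRatio f (s * Δ) < ⊤ := by
  obtain ⟨M, hM, c₀, hc₀⟩ := le_mul_of_limsup_lt_top hf hpos h0 hlim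
  obtain ⟨m, hm⟩ := exists_nat_ge s
  have hfin : ∀ y, 0 ≤ y → f y ≠ ⊤ := fun y hy =>
    ((hf (Set.mem_Ici.2 le_rfl) (Set.mem_Ici.2 hy) hy).trans_lt h0).ne
  let c₁ : ℝ := max (c₀ + m * Δ) (m * Δ)
  have hsm : s * Δ ≤ m * Δ := by gcongr
  have hsΔ : 0 ≤ s * Δ := by positivity
  have hbound : privacyRatio f (s * Δ) ≤ max (M ^ m) (f 0 / f (c₁ ^ 2)) := by
    refine iSup₂_le fun c hc => ?_
    rcases le_total c₁ c with h | h
    · refine le_max_of_le_left ?_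
      rw [ENNReal.div_le_iff (hpos _ (sq_nonneg c)).ne' (hfin _ (sq_nonneg c))]
      refine le_trans ?_ (le_pow_mul_of_le_mul hc₀ hΔ m c ((le_max_left _ _).trans h))
      have h1 : 0 ≤ c - m * Δ := sub_nonneg.2 ((le_max_right _ _).trans h)
      exact hf (Set.mem_Ici.2 (sq_nonneg _)) (Set.mem_Ici.2 (sq_nonneg _)) (by gcongr)
    · refine le_max_of_le_right ?_
      have hc0 : 0 ≤ c := hsΔ.trans hc
      exact ENNReal.div_le_div
        (hf (Set.mem_Ici.2 le_rfl) (Set.mem_Ici.2 (sq_nonneg _)) (sq_nonneg _))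
        (hf (Set.mem_Ici.2 (sq_nonneg _)) (Set.mem_Ici.2 (sq_nonneg _)) (by gcongr))
  refine hbound.trans_lt (max_lt (ENNReal.pow_lt_top hM.lt_top) ?_)
  exact ENNReal.div_lt_top h0.ne (hpos _ (sq_nonneg _)).ne'

lemma one_le_privacyRatio (hf : AntitoneOn f (Set.Ici 0)) (hpos : ∀ y, 0 ≤ y → 0 < f y)
    (h0 : f 0 < ⊤) (b : ℝ) : 1 ≤ privacyRatio f b := by
  have hle : f (b ^ 2) ≤ f 0 := hf (Set.mem_Ici.2 le_rfl) (Set.mem_Ici.2 (sq_nonneg b)) (sq_nonneg b)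
  refine le_trans ?_ (le_iSup₂_of_le b le_rfl le_rfl)
  rw [ENNReal.le_div_iff_mul_le (.inl (hpos _ (sq_nonneg b)).ne') (.inl (hle.trans_lt h0).ne)]
  simpa using hle

/-- Values of a density generator at radii at distance at most `b` are comparable. -/
lemma le_privacyRatio_mul (hf : AntitoneOn f (Set.Ici 0)) (hpos : ∀ y, 0 ≤ y → 0 < f y)
    (h0 : f 0 < ⊤) {b r s : ℝ} (hs : 0 ≤ s) (hsr : s ≤ r + b) :
    f (r ^ 2) ≤ privacyRatio f b * f (s ^ 2) := by
  have key : ∀ c, b ≤ c → f ((c - b) ^ 2) ≤ privacyRatio f b * f (c ^ 2) := fun c hc => by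
    have hfin : f (c ^ 2) ≠ ⊤ :=
      ((hf (Set.mem_Ici.2 le_rfl) (Set.mem_Ici.2 (sq_nonneg c)) (sq_nonneg c)).trans_lt h0).ne
    rw [← ENNReal.div_le_iff (hpos _ (sq_nonneg c)).ne' hfin]
    exact le_iSup₂_of_le c hc le_rfl
  rcases le_total b s with h | h
  · refine (hf (Set.mem_Ici.2 (sq_nonneg _)) (Set.mem_Ici.2 (sq_nonneg _)) ?_).trans (key s h)
    have : 0 ≤ s - b := sub_nonneg.2 h
    gcongr
    linarith
  · calc f (r ^ 2) ≤ f ((b - b) ^ 2) :=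
        hf (Set.mem_Ici.2 (sq_nonneg _)) (Set.mem_Ici.2 (sq_nonneg _)) (by simp [sq_nonneg])
      _ ≤ privacyRatio f b * f (b ^ 2) := key b le_rfl
      _ ≤ privacyRatio f b * f (s ^ 2) := by
        gcongr
        exact hf (Set.mem_Ici.2 (sq_nonneg _)) (Set.mem_Ici.2 (sq_nonneg _)) (by gcongr)

/-- A spherical measure dominates its translates by vectors of length at most `b`, up to the privacy
ratio. -/
lemma map_add_right_le {d : ℕ} (hf : AntitoneOn f (Set.Ici 0)) (hpos : ∀ y, 0 ≤ y → 0 < f y)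
    (h0 : f 0 < ⊤) {b : ℝ} {k : ℝ≥0∞} {Q : Measure (EuclideanSpace ℝ (Fin d))}
    (hQ : Q = volume.withDensity fun x => k * f (‖x‖ ^ 2)) {w : EuclideanSpace ℝ (Fin d)}
    (hw : ‖w‖ ≤ b) : Q.map (fun z => z + w) ≤ privacyRatio f b • Q := by
  have hm : Measurable fun x : EuclideanSpace ℝ (Fin d) => k * f (‖x‖ ^ 2) :=
    (measurable_comp_of_antitoneOn hf (by fun_prop) fun x => sq_nonneg _).const_mul k
  have hm' : Measurable fun x : EuclideanSpace ℝ (Fin d) => k * f (‖x - w‖ ^ 2) :=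
    hm.comp (measurable_sub_const w)
  have h1 := map_withDensity_comp volume (measurable_add_const w) hm'
  simp only [add_sub_cancel_right] at h1
  rw [hQ, h1, map_add_right_eq_self, ← withDensity_smul _ hm]
  refine withDensity_mono (.of_forall fun x => ?_)
  simp only [Pi.smul_apply, smul_eq_mul]
  calc k * f (‖x - w‖ ^ 2) ≤ k * (privacyRatio f b * f (‖x‖ ^ 2)) := by
        gcongr
        refine le_privacyRatio_mul hf hpos h0 (norm_nonneg _) ?_
        calc ‖x‖ = ‖(x - w) + w‖ := by rw [sub_add_cancel]
          _ ≤ ‖x - w‖ + ‖w‖ := norm_add_le _ _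
          _ ≤ ‖x - w‖ + b := by gcongr
    _ = privacyRatio f b * (k * f (‖x‖ ^ 2)) := by ring

variable {X : Type*} [AddCommGroup X] [Module ℝ X] [TopologicalSpace X]
  [IsTopologicalAddGroup X] [ContinuousSMul ℝ X] {C : DispersionForm X}
  [MeasurableSpace X] [BorelSpace X] {P : Measure X} {φ₀ : ℝ → ℂ} {d : ℕ} {σ : ℝ}

/-- The projections of the sanitized summary have elliptical densities. -/
theorem exists_map_mechanism_eq_withDensity {𝓓 : Type*} {T : 𝓓 → X} (hφ₀ : IsEllipticalFamily φ₀)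
    (hP : IsElliptical P 0 C φ₀) (hσ : 0 < σ) (hf : IsDensityGenerator d φ₀ f)
    (g : Fin d → K C) (v : ∀ i, Version C P (g i)) (hv : ∀ D i, T D ∈ (v i).domain)
    (hg : LinearIndependent ℝ g) :
    ∃ k : ℝ≥0∞, k ≠ 0 ∧ k ≠ ⊤ ∧ ∀ D : 𝓓,
      (mechanism P σ (T D)).map (fun y i => (v i).eval y) =
        (volume : Measure (Fin d → ℝ)).withDensity (fun x =>
          k * f (σ⁻¹ ^ 2 * ((x - fun i => (v i).eval (T D)) ⬝ᵥ
            ((Matrix.gram ℝ g)⁻¹.mulVec (x - fun i => (v i).eval (T D)))))) := by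
  obtain ⟨hanti, -, Q, hQ, hchar, k, hk0, hk, hQd⟩ := hf
  obtain ⟨L, hL, -⟩ := exists_contraction_euclideanSpace g
  have hgram : Matrix.gram ℝ (fun i => L (g i)) = Matrix.gram ℝ g := by
    ext i j
    simp [Matrix.gram_apply, hL]
  obtain ⟨c, hc0, hc, h⟩ := map_affine_withDensity hanti k (fun i => L (g i))
    (by rw [hgram]; exact Matrix.posDef_gram_of_linearIndependent hg) hσ
  refine ⟨c * k, mul_ne_zero hc0 hk0, ENNReal.mul_ne_top hc hk, fun D => ?_⟩
  rw [map_mechanism_eq hφ₀ hP hchar v (fun i j => hL i (g j)) σ (hv D), hQd,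
    h fun i => (v i).eval (T D), hgram]
  simp_rw [mul_assoc]

/-- The projections of the sanitized summary are differentially private. -/
theorem isDP_map_mechanism {𝓓 : Type*} [MetricSpace 𝓓] {T : 𝓓 → X}
    (hφ₀ : IsEllipticalFamily φ₀) (hP : IsElliptical P 0 C φ₀)
    (hT : sensitivity C T < ⊤) (hσ : 0 < σ) (hf : IsDensityGenerator d φ₀ f) (h0 : f 0 < ⊤)
    {ε : ℝ}
    (hε : ENNReal.ofReal (Real.exp ε) = privacyRatio f (σ⁻¹ * (sensitivity C T).toReal))
    (g : Fin d → K C) (v : ∀ i, Version C P (g i)) (hv : ∀ D i, T D ∈ (v i).domain) :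
    IsDP ε 0 (fun D => (mechanism P σ (T D)).map (fun y i => (v i).eval y)) := by
  obtain ⟨hanti, hpos, Q, hQ, hchar, k, -, -, hQd⟩ := hf
  obtain ⟨L, hL, hLn⟩ := exists_contraction_euclideanSpace g
  intro D D' hD A hA
  obtain ⟨h, hh, hhn⟩ := exists_isImage_of_dist_le hT hD
  let Φ : EuclideanSpace ℝ (Fin d) → Fin d → ℝ :=
    fun z i => (v i).eval (T D') + σ * inner ℝ (L (g i)) z
  have hΦ : Measurable Φ := by fun_prop
  let w : EuclideanSpace ℝ (Fin d) := σ⁻¹ • L h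
  have hw : ‖w‖ ≤ σ⁻¹ * (sensitivity C T).toReal := by
    rw [norm_smul, Real.norm_of_nonneg (by positivity)]
    gcongr
    exact (hLn h).trans hhn
  have hshift : (fun z i => (v i).eval (T D) + σ * inner ℝ (L (g i)) z) = Φ ∘ fun z => z + w := by
    funext z i
    have h1 := (v i).eval_add_smul (hv D' i) ((v i).eval_of_isImage hh).1 1
    rw [one_smul, add_sub_cancel, ((v i).eval_of_isImage hh).2] at h1
    simp only [Φ, w, Function.comp_apply]
    rw [h1, inner_add_right, real_inner_smul_right, hL, real_inner_comm h]
    field_simp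
    ring
  have hmono := map_add_right_le hanti hpos h0 hQd hw
  simp only
  rw [map_mechanism_eq hφ₀ hP hchar v (fun i j => hL i (g j)) σ (hv D),
    map_mechanism_eq hφ₀ hP hchar v (fun i j => hL i (g j)) σ (hv D'), hshift,
    ← Measure.map_map hΦ (measurable_add_const w), Measure.map_apply hΦ hA,
    Measure.map_apply hΦ hA, hε, ENNReal.ofReal_zero, add_zero]
  exact hmono (Φ ⁻¹' A)

end Privacy

end EllipticalDP

open EllipticalDP
theorem corollary1 (d : ℕ) (φ₀ : ℝ → ℂ) (hφ₀ : IsEllipticalFamily φ₀)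
    {X : Type*} [AddCommGroup X] [Module ℝ X] [TopologicalSpace X] [IsTopologicalAddGroup X]
    [ContinuousSMul ℝ X] [LocallyConvexSpace ℝ X] [T2Space X] [MeasurableSpace X] [BorelSpace X]
    (C : DispersionForm X) (P : Measure X) (hP : IsElliptical P 0 C φ₀)
    {𝓓 : Type*} [MetricSpace 𝓓] (T : 𝓓 → X) (hT : sensitivity C T < ⊤)
    (σ : ℝ) (hσ : 0 < σ) :
    -- every element of `𝒦` has a version, unique almost everywhere, which is defined on the
    -- Cameron–Martin space and takes there the values given by duality
    (∀ g : K C, Nonempty (Version C P g) ∧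
      (∀ v w : Version C P g, v.eval =ᵐ[P] w.eval) ∧
      ∀ (v : Version C P g) (k : K C) (h : X), IsImage C k h →
        h ∈ v.domain ∧ v.eval h = inner ℝ k g) ∧
    -- the family has a density generator in dimension `d`
    (∃ f : ℝ → ℝ≥0∞, IsDensityGenerator d φ₀ f) ∧
    ∀ f : ℝ → ℝ≥0∞, IsDensityGenerator d φ₀ f →
      -- the density of the projections
      (∀ (g : Fin d → K C) (v : ∀ i, Version C P (g i)),
        (∀ D i, T D ∈ (v i).domain) → LinearIndependent ℝ g →
        ∃ k : ℝ≥0∞, k ≠ 0 ∧ k ≠ ⊤ ∧ ∀ D : 𝓓,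
          (mechanism P σ (T D)).map (fun y i => (v i).eval y) =
            (volume : Measure (Fin d → ℝ)).withDensity (fun x =>
              k * f (σ⁻¹ ^ 2 * ((x - fun i => (v i).eval (T D)) ⬝ᵥ
                ((Matrix.gram ℝ g)⁻¹.mulVec (x - fun i => (v i).eval (T D))))))) ∧
      -- differential privacy of the projections, uniformly in their choice
      (f 0 < ⊤ →
        limsup (fun c : ℝ => f ((c - (sensitivity C T).toReal) ^ 2) / f (c ^ 2)) atTop < ⊤ →
        privacyRatio f (σ⁻¹ * (sensitivity C T).toReal) < ⊤ ∧
        ∃ ε : ℝ, 0 ≤ ε ∧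
          ENNReal.ofReal (Real.exp ε) = privacyRatio f (σ⁻¹ * (sensitivity C T).toReal) ∧
          ∀ (g : Fin d → K C) (v : ∀ i, Version C P (g i)), (∀ D i, T D ∈ (v i).domain) →
            IsDP ε 0 (fun D => (mechanism P σ (T D)).map (fun y i => (v i).eval y))) := by
  refine ⟨fun g => ⟨nonempty_version hφ₀ hP g, fun v w => v.eval_ae_eq hφ₀ hP w,
    fun v k h hk => v.eval_of_isImage hk⟩, exists_isDensityGenerator hφ₀ d, fun f hf =>
    ⟨fun g v hv hg => exists_map_mechanism_eq_withDensity hφ₀ hP hσ hf g v hv hg,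
      fun h0 hlim => ?_⟩⟩
  have hlt := privacyRatio_lt_top hf.1 hf.2.1 h0 ENNReal.toReal_nonneg hlim (inv_pos.2 hσ).le
  have hone := one_le_privacyRatio hf.1 hf.2.1 h0 (σ⁻¹ * (sensitivity C T).toReal)
  have hone' : 1 ≤ (privacyRatio f (σ⁻¹ * (sensitivity C T).toReal)).toReal := by
    simpa using ENNReal.toReal_mono hlt.ne hone
  have hε : ENNReal.ofReal (Real.exp (Real.log
      (privacyRatio f (σ⁻¹ * (sensitivity C T).toReal)).toReal))
      = privacyRatio f (σ⁻¹ * (sensitivity C T).toReal) := by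
    rw [Real.exp_log (by linarith), ENNReal.ofReal_toReal hlt.ne]
  exact ⟨hlt, _, Real.log_nonneg hone', hε, fun g v hv =>
    isDP_map_mechanism hφ₀ hP hT hσ hf h0 hε g v hv⟩
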